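/- Let $\mathbb D$ be the open unit disc, $\mathbb T=\partial\mathbb D$, and let $\mathbb C^n$ carry the Euclidean norm. Let $b:\mathbb D\to\mathbb C^{n\times n}$ be analytic with $\|b(z)\|<1$ (operator norm) for every $z\in\mathbb D$, let $\alpha$ be a unitary $n\times n$ matrix, and let $$H_\alpha(z)=(I_n+b(z)\alpha^*)(I_n-b(z)\alpha^*)^{-1},\qquad z\in\mathbb D .$$ Let $\boldsymbol\mu^\alpha$ be the Aleksandrov--Clark measure of $b$, i.e. the (unique) finite non-negative $\mathbb C^{n\times n}$-valued Borel measure on $\mathbb T$ such that $$H_\alpha(z)=i\,\operatorname{Im}H_\alpha(0)+\int_{\mathbb T}\frac{\zeta+z}{\zeta-z}\,\boldsymbol\mu^\alpha(d\zeta)\qquad\text{for all }z\in\mathbb D,$$ where $\operatorname{Im}A=(A-A^*)/(2i)$. For $\lambda\in\mathbb T$ and $t>1$ let $\Gamma_t(\lambda)=\{z\in\mathbb D:|z-\lambda|<t(1-|z|)\}$. Say that $z\to\lambda$ non-tangentially if $z\to\lambda$ from within such a region: a non-tangential limit is a limit from within $\Gamma_t(\lambda)$ for every $t>1$, and a non-tangential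 lower limit is finite if the lower limit from within $\Gamma_t(\lambda)$ is finite for some $t>1$. Let $E_\alpha(\lambda)$ be the set of all $x\in\mathbb C^n$ such that $$\lim_{z\to\lambda}b(z)^*x=\alpha^*x\qquad\text{and}\qquad \liminf_{z\to\lambda}\frac{\|x\|^2-\|b(z)^*x\|^2}{1-|z|^2}<\infty ,$$ both taken non-tangentially (the second condition is the Carathéodory condition for $b$ at $\lambda$ in the codirection $x$). Then for every $\lambda\in\mathbb T$ $$\operatorname{Ran}\boldsymbol\mu^\alpha(\{\lambda\})=E_\alpha(\lambda).$$ -/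

import Mathlib

open Filter Topology MeasureTheory

namespace ClarkMeasure

/-- The unit circle `𝕋 = ∂𝔻`, with its Borel sets. -/
abbrev UnitCircle : Type := Metric.sphere (0 : ℂ) 1

/-- Countably additive Borel measures on the unit circle with values in the `n × n` complex
matrices. -/
abbrev MatrixMeasure (n : ℕ) : Type :=
  VectorMeasure UnitCircle (Matrix (Fin n) (Fin n) ℂ)

/-- The matrix `A`, acting on `ℂⁿ` with its Euclidean norm. -/
noncomputable abbrev act {n : ℕ} (A : Matrix (Fin n) (Fin n) ℂ) :
    EuclideanSpace ℂ (Fin n) →ₗ[ℂ] EuclideanSpace ℂ (Fin n) :=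
  Matrix.toEuclideanLin A

/-- `Im A = (A - A*) / (2i)`. -/
noncomputable def imPart {n : ℕ} (A : Matrix (Fin n) (Fin n) ℂ) : Matrix (Fin n) (Fin n) ℂ :=
  (2 * Complex.I)⁻¹ • (A - A.conjTranspose)

/-- The Herglotz function `H_α(z) = (I + b(z) α*) (I - b(z) α*)⁻¹`. -/
noncomputable def herglotz {n : ℕ} (b : ℂ → Matrix (Fin n) (Fin n) ℂ)
    (α : Matrix (Fin n) (Fin n) ℂ) (z : ℂ) : Matrix (Fin n) (Fin n) ℂ :=
  (1 + b z * α.conjTranspose) * (1 - b z * α.conjTranspose)⁻¹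

section OperatorNorm

open scoped Matrix.Norms.L2Operator

/-- The Schur class `𝒮(n)`: analytic matrix-valued functions on the open unit disc that are purely
contractive, `‖b(z)‖ < 1` in the operator norm (largest singular value) at every `z ∈ 𝔻`. -/
structure IsSchur {n : ℕ} (b : ℂ → Matrix (Fin n) (Fin n) ℂ) : Prop where
  differentiableOn : DifferentiableOn ℂ b (Metric.ball 0 1)
  norm_lt_one : ∀ z ∈ Metric.ball (0 : ℂ) 1, ‖b z‖ < 1

/-- `∫ f dμ` for a scalar function `f` and a matrix-valued measure `μ`. -/
noncomputable def matrixIntegral {n : ℕ} (μ : MatrixMeasure n) (f : UnitCircle → ℂ) :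
    Matrix (Fin n) (Fin n) ℂ :=
  VectorMeasure.integral μ f (ContinuousLinearMap.lsmul ℝ ℂ)

end OperatorNorm

section Positivity

open scoped ComplexOrder

/-- `μ` is the Aleksandrov--Clark measure `μ^α` of `b`: the non-negative matrix-valued Borel measure
on the circle that represents the Herglotz function `H_α` on the disc. -/
structure IsClarkMeasure {n : ℕ} (b : ℂ → Matrix (Fin n) (Fin n) ℂ)
    (α : Matrix (Fin n) (Fin n) ℂ) (μ : MatrixMeasure n) : Prop where
  posSemidef : ∀ s, MeasurableSet s → (μ s).PosSemidef
  herglotz_eq : ∀ z ∈ Metric.ball (0 : ℂ) 1,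
    herglotz b α z = Complex.I • imPart (herglotz b α 0) +
      matrixIntegral μ (fun ζ : UnitCircle => ((ζ : ℂ) + z) / ((ζ : ℂ) - z))

end Positivity

/-- The Stolz region `Γ_t(l)`. -/
def stolz (t : ℝ) (l : UnitCircle) : Set ℂ :=
  {z | ‖z‖ < 1 ∧ ‖z - l‖ < t * (1 - ‖z‖)}

/-- The filter of non-tangential approach to `l`. A limit along it is a limit from within every
Stolz region `Γ_t(l)`, `t > 1`; a lower limit along it is the infimum over `t > 1` of the lower
limits from within `Γ_t(l)`. -/
noncomputable def nontangential (l : UnitCircle) : Filter ℂ :=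
  ⨆ t ∈ Set.Ioi (1 : ℝ), 𝓝[stolz t l] (l : ℂ)

/-- The Carathéodory condition for `b` at `l` in the codirection `x`. -/
def CaratheodoryCondition {n : ℕ} (b : ℂ → Matrix (Fin n) (Fin n) ℂ) (l : UnitCircle)
    (x : EuclideanSpace ℂ (Fin n)) : Prop :=
  liminf (fun z : ℂ =>
    (((‖x‖ ^ 2 - ‖act (b z).conjTranspose x‖ ^ 2) / (1 - ‖z‖ ^ 2) : ℝ) : EReal))
    (nontangential l) < ⊤

/-- The directional carrier `S_α(l)`. -/
def directionalCarrier {n : ℕ} (b : ℂ → Matrix (Fin n) (Fin n) ℂ)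
    (α : Matrix (Fin n) (Fin n) ℂ) (l : UnitCircle) : Set (EuclideanSpace ℂ (Fin n)) :=
  {x | Tendsto (fun z => act (b z).conjTranspose x) (nontangential l)
    (𝓝 (act α.conjTranspose x))}

/-- The set `E_α(l)`. -/
def caratheodorySpace {n : ℕ} (b : ℂ → Matrix (Fin n) (Fin n) ℂ)
    (α : Matrix (Fin n) (Fin n) ℂ) (l : UnitCircle) : Set (EuclideanSpace ℂ (Fin n)) :=
  {x | x ∈ directionalCarrier b α l ∧ CaratheodoryCondition b l x}

end ClarkMeasure

namespace ClarkMeasure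

/-! Write M for the point mass at l and k_z for the Szegő kernel. The Herglotz representation gives
H(w) + H(z)* = 2(1 - w z̄) ∫ k_z k̄_w dμ, so Cauchy-Schwarz for the positive form ∫ f ḡ ⟨v, dμ u⟩
applies to H. The link with b is the vector u = (1 - α b(z)*)x (`defect`): the form of H(z) + H(z)*
at u is 2(‖x‖² - ‖b(z)*x‖²), the Carathéodory numerator. Also (1 - l̄z)/2 · H(z) → M
non-tangentially, by dominated convergence (`IsClarkMeasure.tendsto_smul_herglotz`).

Range of M inside E_α: (H + 1)(1 - bα*) = 2, so multiplying by 1 - l̄z and passing to the limit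
gives b(z)*M → α*M. For x = My, Cauchy-Schwarz between k_z u and the indicator of {l} times y bounds
the quotient along the radius (`IsClarkMeasure.quotient_radial_le`).

E_α inside the range: if the quotient is frequently at most A, Cauchy-Schwarz between k_z u and k_w
v, with z → l and then w → l radially, gives |⟨v, x⟩|² ≤ A⟨v, Mv⟩
(`IsClarkMeasure.norm_inner_sq_le_atom`). Hence x is orthogonal to ker M = (Ran M)^⊥. -/

/-- A vector measure with values in a finite-dimensional normed space has finite variation. -/
theorem isFiniteMeasure_variation {X F : Type*} [MeasurableSpace X] [NormedAddCommGroup F]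
    [NormedSpace ℝ F] [FiniteDimensional ℝ F] (μ : VectorMeasure X F) :
    IsFiniteMeasure μ.variation := by
  let b := Module.finBasis ℝ F
  let φ : Fin (Module.finrank ℝ F) → F →L[ℝ] ℝ := fun i =>
    LinearMap.toContinuousLinearMap (b.coord i)
  let ν : Fin (Module.finrank ℝ F) → SignedMeasure X := fun i =>
    μ.mapRange (φ i).toLinearMap.toAddMonoidHom (φ i).continuous
  -- The coordinates are signed measures, whose total variations are finite; this weighted sum of
  -- them dominates the variation of `μ`.
  let m : Measure X := ∑ i, ‖b i‖₊ • (ν i).variation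
  have hν : ∀ i, IsFiniteMeasure (ν i).variation := fun i => by
    rw [← SignedMeasure.totalVariation_eq_variation]; infer_instance
  have hle : μ.variation ≤ m := by
    refine VectorMeasure.variation_le_of_forall_enorm_le fun s _ => ?_
    calc ‖μ s‖ₑ = ‖∑ i, b.coord i (μ s) • b i‖ₑ := by
          simp only [Module.Basis.coord_apply, b.sum_repr]
      _ ≤ ∑ i, ‖b.coord i (μ s) • b i‖ₑ := enorm_sum_le _ _
      _ ≤ m s := by
          rw [show m s = ∑ i, ‖b i‖ₑ * (ν i).variation s by
            simp only [m, Measure.coe_finsetSum, Finset.sum_apply]; rfl]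
          refine Finset.sum_le_sum fun i _ => ?_
          rw [enorm_smul, mul_comm]
          gcongr
          exact VectorMeasure.enorm_measure_le_variation (ν i) s
  have : IsFiniteMeasure m := ⟨by
    simp only [m, Measure.coe_finsetSum, Finset.sum_apply]
    exact ENNReal.sum_lt_top.2 fun i _ => measure_lt_top _ _⟩
  exact isFiniteMeasure_of_le m hle

/-! ### Integration against positive matrix measures -/

section Integral

open scoped Matrix.Norms.L2Operator

variable {n : ℕ} (μ : MatrixMeasure n)

instance : IsFiniteMeasure μ.variation :=
  haveI : FiniteDimensional ℝ (Matrix (Fin n) (Fin n) ℂ) := FiniteDimensional.trans ℝ ℂ _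
  isFiniteMeasure_variation μ

theorem integrable_of_bound {f : UnitCircle → ℂ} (hf : Measurable f) {C : ℝ}
    (hC : ∀ ζ, ‖f ζ‖ ≤ C) : μ.Integrable f :=
  Integrable.of_bound hf.aestronglyMeasurable C (Eventually.of_forall hC)

theorem matrixIntegral_indicator {s : Set UnitCircle} (hs : MeasurableSet s) (a : ℂ) :
    matrixIntegral μ (s.indicator fun _ => a) = a • μ s := by
  unfold matrixIntegral
  rw [VectorMeasure.integral_eq_setToFun]
  exact setToFun_indicator_const _ hs (measure_ne_top _ _) a

theorem matrixIntegral_smul (a : ℂ) (f : UnitCircle → ℂ) :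
    matrixIntegral μ (fun ζ => a * f ζ) = a • matrixIntegral μ f :=
  setToFun_smul _ (fun c s x => by
    change (c • x) • μ s = c • x • μ s
    rw [smul_assoc]) a f

theorem matrixIntegral_add {f g : UnitCircle → ℂ} (hf : μ.Integrable f) (hg : μ.Integrable g) :
    matrixIntegral μ (fun ζ => f ζ + g ζ) = matrixIntegral μ f + matrixIntegral μ g :=
  VectorMeasure.integral_fun_add hf hg

theorem matrixIntegral_comp_simpleFunc {V : Type*} (S : SimpleFunc UnitCircle V) (g : V → ℂ) :
    matrixIntegral μ (fun ζ => g (S ζ)) = ∑ a ∈ S.range, g a • μ (S ⁻¹' {a}) := by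
  classical
  have h : (fun ζ => g (S ζ)) =
      fun ζ => ∑ a ∈ S.range, (S ⁻¹' {a}).indicator (fun _ => g a) ζ := by
    funext ζ
    rw [Finset.sum_eq_single (S ζ)]
    · simp
    · intro a _ ha
      exact Set.indicator_of_notMem (fun h => ha (by simpa using h.symm)) _
    · intro h
      exact absurd (S.mem_range_self ζ) h
  rw [h]
  unfold matrixIntegral
  rw [VectorMeasure.integral_finsetSum]
  · exact Finset.sum_congr rfl fun a _ =>
      matrixIntegral_indicator μ (S.measurableSet_fiber a) (g a)
  · intro a _
    exact (integrable_const (g a)).indicator (S.measurableSet_fiber a)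

/-- A bounded measurable pair of functions is approximated by simple functions, simultaneously for
all integrands that depend continuously on it. -/
theorem exists_simpleFunc_tendsto_matrixIntegral {F : UnitCircle → ℂ × ℂ} (hF : Measurable F)
    {C : ℝ} (hC : ∀ ζ, ‖F ζ‖ ≤ C) :
    ∃ S : ℕ → SimpleFunc UnitCircle (ℂ × ℂ), ∀ g : ℂ × ℂ → ℂ, Continuous g →
      Tendsto (fun k => ∑ a ∈ (S k).range, g a • μ (S k ⁻¹' {a})) atTop
        (𝓝 (matrixIntegral μ fun ζ => g (F ζ))) := by
  refine ⟨fun k => SimpleFunc.approxOn F hF Set.univ 0 (Set.mem_univ _) k, fun g hg => ?_⟩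
  simp only [← matrixIntegral_comp_simpleFunc]
  -- `norm_approxOn_zero_le` bounds the approximants by twice the norm of `F`, hence the radius `C +
  -- C`.
  obtain ⟨D, hD⟩ := (isCompact_closedBall (0 : ℂ × ℂ) (C + C)).exists_bound_of_continuousOn
    hg.continuousOn
  refine VectorMeasure.tendsto_integral_filter_of_norm_le_const ?_ ⟨D, ?_⟩ ?_
  · exact Eventually.of_forall fun k =>
      (hg.measurable.comp (SimpleFunc.measurable _)).aestronglyMeasurable
  · refine Eventually.of_forall fun k => Eventually.of_forall fun ζ => hD _ ?_
    rw [mem_closedBall_zero_iff]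
    exact (SimpleFunc.norm_approxOn_zero_le hF _ ζ k).trans (add_le_add (hC ζ) (hC ζ))
  · exact Eventually.of_forall fun ζ => (hg.tendsto _).comp
      (SimpleFunc.tendsto_approxOn hF _ (by simp))

open scoped ComplexOrder

theorem conjTranspose_matrixIntegral (hμ : ∀ s, MeasurableSet s → (μ s).PosSemidef)
    {f : UnitCircle → ℂ} (hf : Measurable f) {C : ℝ} (hC : ∀ ζ, ‖f ζ‖ ≤ C) :
    (matrixIntegral μ f).conjTranspose = matrixIntegral μ fun ζ => star (f ζ) := by
  obtain ⟨S, hS⟩ := exists_simpleFunc_tendsto_matrixIntegral μ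
    (F := fun ζ => (f ζ, f ζ)) (hf.prodMk hf) (C := C) (fun ζ => by simpa using hC ζ)
  have h1 := hS (fun a => a.1) continuous_fst
  have h2 := hS (fun a => star a.1) (by fun_prop)
  have h3 := (Continuous.tendsto (continuous_id.matrix_conjTranspose) _).comp h1
  refine tendsto_nhds_unique h3 (h2.congr fun k => ?_)
  simp only [Function.comp, id, Matrix.conjTranspose_sum, Matrix.conjTranspose_smul]
  refine Finset.sum_congr rfl fun a _ => ?_
  rw [(hμ _ ((S k).measurableSet_fiber a)).isHermitian.eq]

theorem continuous_inner_act (u v : EuclideanSpace ℂ (Fin n)) :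
    Continuous fun A : Matrix (Fin n) (Fin n) ℂ => inner ℂ u (act A v) := by
  let L : Matrix (Fin n) (Fin n) ℂ →ₗ[ℂ] ℂ :=
    { toFun := fun A => inner ℂ u (act A v)
      map_add' := fun A B => by simp
      map_smul' := fun a A => by simp }
  exact L.continuous_of_finiteDimensional

theorem inner_act_sum_smul {ι : Type*} (s : Finset ι) (g : ι → ℂ)
    (A : ι → Matrix (Fin n) (Fin n) ℂ) (u v : EuclideanSpace ℂ (Fin n)) :
    inner ℂ u (act (∑ i ∈ s, g i • A i) v) = ∑ i ∈ s, g i * inner ℂ u (act (A i) v) := by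
  simp [map_sum, LinearMap.sum_apply]

theorem inner_act_conjTranspose (A : Matrix (Fin n) (Fin n) ℂ) (u v : EuclideanSpace ℂ (Fin n)) :
    inner ℂ u (act A.conjTranspose v) = inner ℂ (act A u) v := by
  rw [act, Matrix.toEuclideanLin_conjTranspose_eq_adjoint, LinearMap.adjoint_inner_right]

theorem re_inner_act_nonneg {A : Matrix (Fin n) (Fin n) ℂ} (hA : A.PosSemidef)
    (u : EuclideanSpace ℂ (Fin n)) : 0 ≤ (inner ℂ u (act A u)).re :=
  (Matrix.isPositive_toEuclideanLin_iff.2 hA).re_inner_nonneg_right u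

/-- The quadratic form of a positive matrix measure at the vector function `f u + g v`. -/
theorem matrixIntegral_form_nonneg (hμ : ∀ s, MeasurableSet s → (μ s).PosSemidef)
    {f g : UnitCircle → ℂ} (hf : Measurable f) (hg : Measurable g) {C : ℝ}
    (hfC : ∀ ζ, ‖f ζ‖ ≤ C) (hgC : ∀ ζ, ‖g ζ‖ ≤ C) (u v : EuclideanSpace ℂ (Fin n)) :
    0 ≤ (inner ℂ u (act (matrixIntegral μ fun ζ => f ζ * star (f ζ)) u)).re +
      2 * (inner ℂ v (act (matrixIntegral μ fun ζ => f ζ * star (g ζ)) u)).re +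
      (inner ℂ v (act (matrixIntegral μ fun ζ => g ζ * star (g ζ)) v)).re := by
  obtain ⟨S, hS⟩ := exists_simpleFunc_tendsto_matrixIntegral μ
    (F := fun ζ => (f ζ, g ζ)) (hf.prodMk hg) (C := C)
    (fun ζ => by simpa [Prod.norm_def] using ⟨hfC ζ, hgC ζ⟩)
  have lim (φ : ℂ × ℂ → ℂ) (hφ : Continuous φ) (x y : EuclideanSpace ℂ (Fin n)) :=
    (Complex.continuous_re.tendsto _).comp
      (((continuous_inner_act x y).tendsto _).comp (hS φ hφ))
  refine ge_of_tendsto' (((lim (fun a => a.1 * star a.1) (by fun_prop) u u).add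
    ((lim (fun a => a.1 * star a.2) (by fun_prop) v u).const_mul 2)).add
    (lim (fun a => a.2 * star a.2) (by fun_prop) v v)) fun k => ?_
  simp only [Function.comp, inner_act_sum_smul, Complex.re_sum, Finset.mul_sum,
    ← Finset.sum_add_distrib]
  refine Finset.sum_nonneg fun a _ => ?_
  have hA := hμ _ ((S k).measurableSet_fiber a)
  set A := μ (S k ⁻¹' {a})
  -- On each fibre the sum is the form of `A` at one vector; since `A` is Hermitian, the two cross
  -- terms are conjugate and their real parts add up.
  have h := re_inner_act_nonneg hA (a.1 • u + a.2 • v)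
  have hs : inner ℂ u (act A v) = star (inner ℂ v (act A u)) := by
    conv_lhs => rw [← hA.isHermitian.eq]
    rw [inner_act_conjTranspose]
    exact (inner_conj_symm _ _).symm
  simp only [map_add, map_smul, inner_add_left, inner_add_right, inner_smul_left,
    inner_smul_right, hs] at h
  simp only [Complex.add_re, Complex.add_im, Complex.mul_re, Complex.mul_im, Complex.star_def,
    Complex.conj_re, Complex.conj_im] at h ⊢
  linarith

/-- Cauchy-Schwarz for a positive matrix measure. -/
theorem norm_inner_matrixIntegral_sq_le (hμ : ∀ s, MeasurableSet s → (μ s).PosSemidef)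
    {f g : UnitCircle → ℂ} (hf : Measurable f) (hg : Measurable g) {C : ℝ}
    (hfC : ∀ ζ, ‖f ζ‖ ≤ C) (hgC : ∀ ζ, ‖g ζ‖ ≤ C) (u v : EuclideanSpace ℂ (Fin n)) :
    ‖inner ℂ v (act (matrixIntegral μ fun ζ => f ζ * star (g ζ)) u)‖ ^ 2 ≤
      (inner ℂ u (act (matrixIntegral μ fun ζ => f ζ * star (f ζ)) u)).re *
      (inner ℂ v (act (matrixIntegral μ fun ζ => g ζ * star (g ζ)) v)).re := by
  set X := inner ℂ v (act (matrixIntegral μ fun ζ => f ζ * star (g ζ)) u) with hX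
  -- The phase `e` makes the cross term real: replacing `v` by `t e v` yields a quadratic in real
  -- `t` that is never negative.
  obtain ⟨e, he, heX⟩ : ∃ e : ℂ, ‖e‖ = 1 ∧ star e * X = ‖X‖ := by
    rcases eq_or_ne X 0 with h0 | h0
    · exact ⟨1, by simp, by simp [h0]⟩
    · refine ⟨X / ‖X‖, by simp [h0], ?_⟩
      have : (‖X‖ : ℂ) ≠ 0 := by simpa using h0
      simp only [star_div₀, Complex.star_def, Complex.conj_ofReal]
      rw [div_mul_eq_mul_div, mul_comm, Complex.mul_conj, Complex.normSq_eq_norm_sq, div_eq_iff this]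
      push_cast; ring
  have key := discrim_le_zero
    (a := (inner ℂ v (act (matrixIntegral μ fun ζ => g ζ * star (g ζ)) v)).re)
    (b := 2 * ‖X‖)
    (c := (inner ℂ u (act (matrixIntegral μ fun ζ => f ζ * star (f ζ)) u)).re) fun t => by
      have h := matrixIntegral_form_nonneg μ hμ hf hg hfC hgC u (((t : ℂ) * e) • v)
      simp only [map_smul, inner_smul_left, inner_smul_right] at h
      rw [← hX] at h
      have h1 : (starRingEnd ℂ) ((t : ℂ) * e) * X = (t * ‖X‖ : ℝ) := by
        rw [map_mul, Complex.conj_ofReal, mul_assoc]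
        rw [Complex.star_def] at heX
        rw [heX]; push_cast; ring
      have h2 (Y : ℂ) : (t : ℂ) * e * ((starRingEnd ℂ) ((t : ℂ) * e) * Y) =
          ((t * t : ℝ) : ℂ) * Y := by
        rw [← mul_assoc, Complex.mul_conj, Complex.normSq_eq_norm_sq,
          norm_mul, he]
        simp [sq]
      rw [h1, h2, Complex.re_ofReal_mul, Complex.ofReal_re] at h
      linarith
  rw [discrim] at key
  nlinarith
end Integral

end ClarkMeasure

/-! ### Herglotz and Szegő kernels, and the point mass as a limit -/

namespace ClarkMeasure

/-- The Herglotz kernel. -/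
noncomputable def herglotzKernel (z : ℂ) (ζ : UnitCircle) : ℂ := ((ζ : ℂ) + z) / ((ζ : ℂ) - z)

/-- The Szegő kernel. -/
noncomputable def szegoKernel (z : ℂ) (ζ : UnitCircle) : ℂ := (1 - star z * (ζ : ℂ))⁻¹

theorem measurable_herglotzKernel (z : ℂ) : Measurable (herglotzKernel z) := by
  unfold herglotzKernel; fun_prop

theorem measurable_szegoKernel (z : ℂ) : Measurable (szegoKernel z) := by
  unfold szegoKernel; fun_prop

theorem norm_coe (ζ : UnitCircle) : ‖(ζ : ℂ)‖ = 1 := by simp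

theorem star_mul_coe (ζ : UnitCircle) : star (ζ : ℂ) * ζ = 1 := by
  rw [Complex.star_def, Complex.conj_mul', norm_coe]; simp

theorem one_sub_norm_le_norm_sub (z : ℂ) (ζ : UnitCircle) : 1 - ‖z‖ ≤ ‖(ζ : ℂ) - z‖ := by
  simpa using norm_sub_norm_le (ζ : ℂ) z

theorem one_sub_norm_le_norm_one_sub (z : ℂ) (ζ : UnitCircle) :
    1 - ‖z‖ ≤ ‖1 - star z * (ζ : ℂ)‖ := by
  simpa using norm_sub_norm_le (1 : ℂ) (star z * (ζ : ℂ))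

theorem norm_herglotzKernel_le {z : ℂ} (hz : ‖z‖ < 1) (ζ : UnitCircle) :
    ‖herglotzKernel z ζ‖ ≤ 2 / (1 - ‖z‖) := by
  rw [herglotzKernel, norm_div]
  have h : ‖(ζ : ℂ) + z‖ ≤ 2 := (norm_add_le _ _).trans (by rw [norm_coe]; linarith)
  have := one_sub_norm_le_norm_sub z ζ
  have : 0 < 1 - ‖z‖ := by linarith
  gcongr

theorem norm_szegoKernel_le {z : ℂ} (hz : ‖z‖ < 1) (ζ : UnitCircle) :
    ‖szegoKernel z ζ‖ ≤ (1 - ‖z‖)⁻¹ := by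
  rw [szegoKernel, norm_inv]
  have := one_sub_norm_le_norm_one_sub z ζ
  have : 0 < 1 - ‖z‖ := by linarith
  gcongr

/-- On the circle `star ζ = ζ⁻¹`, so this is an identity of rational functions in `ζ`, `w` and `star
z`. Integrated, it makes H(w) + H(z)* a Gram kernel. -/
theorem herglotzKernel_add_star {w z : ℂ} (hw : ‖w‖ < 1) (hz : ‖z‖ < 1) (ζ : UnitCircle) :
    herglotzKernel w ζ + star (herglotzKernel z ζ) =
      2 * (1 - w * star z) * (szegoKernel z ζ * star (szegoKernel w ζ)) := by
  have h1 : (ζ : ℂ) - w ≠ 0 := norm_pos_iff.1 (by linarith [one_sub_norm_le_norm_sub w ζ])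
  have h2 : 1 - star z * (ζ : ℂ) ≠ 0 :=
    norm_pos_iff.1 (by linarith [one_sub_norm_le_norm_one_sub z ζ])
  have h0 : (ζ : ℂ) ≠ 0 := norm_pos_iff.1 (by simp)
  have hs : star (ζ : ℂ) = (ζ : ℂ)⁻¹ := eq_inv_of_mul_eq_one_left (star_mul_coe ζ)
  have h3 : (ζ : ℂ)⁻¹ - star z ≠ 0 := by
    intro h
    apply h2
    rw [← sub_eq_zero.1 h, inv_mul_cancel₀ h0, sub_self]
  have h4 : 1 - w * (ζ : ℂ)⁻¹ ≠ 0 := by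
    intro h
    apply h1
    have := congrArg (· * (ζ : ℂ)) h
    simpa [sub_mul, h0] using this
  simp only [herglotzKernel, szegoKernel, star_div₀, star_add, star_sub, star_inv₀, star_mul,
    star_star, star_one, hs]
  rw [mul_comm (ζ : ℂ)⁻¹ w]
  have e3 : (ζ : ℂ)⁻¹ - star z = (1 - star z * ζ) * (ζ : ℂ)⁻¹ := by field_simp
  have e4 : 1 - w * (ζ : ℂ)⁻¹ = (ζ - w) * (ζ : ℂ)⁻¹ := by field_simp
  rw [e3, e4]
  generalize star z = s at *
  have h5 : 1 - (ζ : ℂ) * s ≠ 0 := by rwa [mul_comm]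
  field_simp
  ring

section Representation

open scoped Matrix.Norms.L2Operator ComplexOrder

variable {n : ℕ} {b : ℂ → Matrix (Fin n) (Fin n) ℂ} {α : Matrix (Fin n) (Fin n) ℂ}
  {μ : MatrixMeasure n}

theorem I_smul_imPart (A : Matrix (Fin n) (Fin n) ℂ) :
    Complex.I • imPart A = (2⁻¹ : ℂ) • (A - A.conjTranspose) := by
  rw [imPart, smul_smul]
  congr 1
  field_simp

theorem conjTranspose_I_smul_imPart (A : Matrix (Fin n) (Fin n) ℂ) :
    (Complex.I • imPart A).conjTranspose = -(Complex.I • imPart A) := by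
  rw [I_smul_imPart, Matrix.conjTranspose_smul, Matrix.conjTranspose_sub,
    Matrix.conjTranspose_conjTranspose, ← smul_neg, neg_sub]
  simp

/-- The reproducing kernel of the Herglotz space, as an integral. -/
theorem IsClarkMeasure.herglotz_add_conjTranspose (hμ : IsClarkMeasure b α μ) {w z : ℂ}
    (hw : ‖w‖ < 1) (hz : ‖z‖ < 1) :
    herglotz b α w + (herglotz b α z).conjTranspose = (2 * (1 - w * star z)) •
      matrixIntegral μ fun ζ => szegoKernel z ζ * star (szegoKernel w ζ) := by
  -- The constant i Im H(0) is skew-adjoint, so it cancels in the sum.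
  rw [hμ.herglotz_eq w (by simpa using hw), hμ.herglotz_eq z (by simpa using hz),
    Matrix.conjTranspose_add, conjTranspose_I_smul_imPart]
  change _ + matrixIntegral μ (herglotzKernel w) +
    (_ + (matrixIntegral μ (herglotzKernel z)).conjTranspose) = _
  rw [conjTranspose_matrixIntegral μ hμ.posSemidef (measurable_herglotzKernel z)
    (norm_herglotzKernel_le hz), ← matrixIntegral_smul]
  simp only [← herglotzKernel_add_star hw hz]
  rw [matrixIntegral_add μ (integrable_of_bound μ (measurable_herglotzKernel w)
      (norm_herglotzKernel_le hw))
    (integrable_of_bound μ (f := fun ζ => star (herglotzKernel z ζ))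
      (by have := measurable_herglotzKernel z; fun_prop)
      (fun ζ => (norm_star _).trans_le (norm_herglotzKernel_le hz ζ)))]
  abel

theorem mem_stolz_bound {t : ℝ} {l : UnitCircle} {z : ℂ} (hz : z ∈ stolz t l) :
    ‖1 - star (l : ℂ) * z‖ ≤ t * (1 - ‖z‖) := by
  have : 1 - star (l : ℂ) * z = star (l : ℂ) * ((l : ℂ) - z) := by
    rw [mul_sub, star_mul_coe]
  rw [this, norm_mul, norm_star, norm_coe, one_mul, norm_sub_rev]
  exact hz.2.le

theorem nontangential_le_nhds (l : UnitCircle) : nontangential l ≤ 𝓝 (l : ℂ) :=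
  iSup₂_le fun _ _ => nhdsWithin_le_nhds

theorem eventually_nontangential_norm_lt_one (l : UnitCircle) :
    ∀ᶠ z in nontangential l, ‖z‖ < 1 := by
  simp only [nontangential, eventually_iSup]
  intro t _
  filter_upwards [self_mem_nhdsWithin] with z hz using hz.1

theorem tendsto_one_sub_star_mul (l : UnitCircle) :
    Tendsto (fun z : ℂ => (1 - star (l : ℂ) * z) / 2) (𝓝 (l : ℂ)) (𝓝 0) := by
  have : Continuous fun z : ℂ => (1 - star (l : ℂ) * z) / 2 := by fun_prop
  have h := this.tendsto (l : ℂ)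
  rwa [star_mul_coe, sub_self, zero_div] at h

/-- At `ζ = l` the factor 1 - l̄z = l̄(l - z) cancels the pole; elsewhere the kernel stays
continuous at `l` while the factor vanishes. -/
theorem tendsto_scaled_herglotzKernel {t : ℝ} (l ζ : UnitCircle) :
    Tendsto (fun z : ℂ => (1 - star (l : ℂ) * z) / 2 * herglotzKernel z ζ)
      (𝓝[stolz t l] (l : ℂ)) (𝓝 (({l} : Set UnitCircle).indicator (fun _ => (1 : ℂ)) ζ)) := by
  by_cases h : ζ = l
  · subst h
    rw [Set.indicator_of_mem (Set.mem_singleton ζ)]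
    have hc : Continuous fun z : ℂ => star (ζ : ℂ) * ((ζ : ℂ) + z) / 2 := by fun_prop
    have hl := (hc.tendsto (ζ : ℂ)).mono_left (nhdsWithin_le_nhds (s := stolz t ζ))
    rw [mul_add, star_mul_coe] at hl
    norm_num at hl
    refine hl.congr' ?_
    filter_upwards [self_mem_nhdsWithin] with z hz
    have h1 : (ζ : ℂ) - z ≠ 0 :=
      norm_pos_iff.1 (by linarith [one_sub_norm_le_norm_sub z ζ, hz.1])
    have : 1 - star (ζ : ℂ) * z = star (ζ : ℂ) * ((ζ : ℂ) - z) := by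
      rw [mul_sub, star_mul_coe]
    rw [← Complex.star_def, this, herglotzKernel]
    field_simp
  · rw [Set.indicator_of_notMem (by simpa using h)]
    have h1 : (ζ : ℂ) - l ≠ 0 := sub_ne_zero.2 fun e => h (Subtype.ext e)
    have hc : Tendsto (fun z : ℂ => herglotzKernel z ζ) (𝓝 (l : ℂ)) (𝓝 (herglotzKernel l ζ)) := by
      unfold herglotzKernel
      exact ContinuousAt.tendsto (x := (l : ℂ)) (f := fun z : ℂ => ((ζ : ℂ) + z) / ((ζ : ℂ) - z))
        (ContinuousAt.div (by fun_prop) (by fun_prop) h1)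
    simpa using ((tendsto_one_sub_star_mul l).mul hc).mono_left nhdsWithin_le_nhds

/-- The point mass of the Clark measure, as a non-tangential limit of the Herglotz function. -/
theorem IsClarkMeasure.tendsto_smul_herglotz (hμ : IsClarkMeasure b α μ) (l : UnitCircle) :
    Tendsto (fun z => ((1 - star (l : ℂ) * z) / 2) • herglotz b α z) (nontangential l)
      (𝓝 (μ {l})) := by
  have hint : Tendsto (fun z => matrixIntegral μ fun ζ =>
      (1 - star (l : ℂ) * z) / 2 * herglotzKernel z ζ) (nontangential l) (𝓝 (μ {l})) := by
    simp only [nontangential, tendsto_iSup]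
    intro t _
    have hone := matrixIntegral_indicator μ (measurableSet_singleton l) 1
    rw [one_smul] at hone
    rw [← hone]
    -- Domination is where the Stolz region enters: the factor is at most t(1 - |z|)/2 and the
    -- kernel at most 2/(1 - |z|).
    refine VectorMeasure.tendsto_integral_filter_of_norm_le_const ?_ ⟨t, ?_⟩ ?_
    · exact Eventually.of_forall fun z =>
        ((measurable_herglotzKernel z).const_mul _).aestronglyMeasurable
    · filter_upwards [self_mem_nhdsWithin] with z hz
      refine Eventually.of_forall fun ζ => ?_
      have h1 : 0 < 1 - ‖z‖ := by linarith [hz.1]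
      calc ‖(1 - star (l : ℂ) * z) / 2 * herglotzKernel z ζ‖
          ≤ t * (1 - ‖z‖) / 2 * (2 / (1 - ‖z‖)) := by
            rw [norm_mul, norm_div, Complex.norm_ofNat]
            gcongr
            · linarith [(norm_nonneg _).trans (mem_stolz_bound hz)]
            · exact mem_stolz_bound hz
            · exact norm_herglotzKernel_le hz.1 ζ
        _ = t := by field_simp
    · exact Eventually.of_forall fun ζ => tendsto_scaled_herglotzKernel l ζ
  have hconst := ((tendsto_one_sub_star_mul l).mono_left (nontangential_le_nhds l)).smul_const
    (Complex.I • imPart (herglotz b α 0))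
  rw [zero_smul] at hconst
  have := hconst.add hint
  rw [zero_add] at this
  refine this.congr' ?_
  filter_upwards [eventually_nontangential_norm_lt_one l] with z hz
  rw [hμ.herglotz_eq z (by simpa using hz), smul_add, matrixIntegral_smul]
  rfl

end Representation

end ClarkMeasure

/-! ### Cauchy-Schwarz inequalities for the Herglotz function -/

namespace ClarkMeasure

section Kernel

open scoped Matrix.Norms.L2Operator ComplexOrder

variable {n : ℕ} {b : ℂ → Matrix (Fin n) (Fin n) ℂ} {α : Matrix (Fin n) (Fin n) ℂ}
  {μ : MatrixMeasure n}

theorem act_mul (A B : Matrix (Fin n) (Fin n) ℂ) (x : EuclideanSpace ℂ (Fin n)) :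
    act (A * B) x = act A (act B x) := by
  simp [act]

theorem act_one (x : EuclideanSpace ℂ (Fin n)) : act (1 : Matrix (Fin n) (Fin n) ℂ) x = x := by
  simp [act]

theorem act_add (A B : Matrix (Fin n) (Fin n) ℂ) (x : EuclideanSpace ℂ (Fin n)) :
    act (A + B) x = act A x + act B x := by
  simp [act]

theorem act_smul (a : ℂ) (A : Matrix (Fin n) (Fin n) ℂ) (x : EuclideanSpace ℂ (Fin n)) :
    act (a • A) x = a • act A x := by
  simp [act]

theorem continuous_act (x : EuclideanSpace ℂ (Fin n)) :
    Continuous fun A : Matrix (Fin n) (Fin n) ℂ => act A x := by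
  let L : Matrix (Fin n) (Fin n) ℂ →ₗ[ℂ] EuclideanSpace ℂ (Fin n) :=
    { toFun := fun A => act A x
      map_add' := fun A B => by simp
      map_smul' := fun a A => by simp }
  exact L.continuous_of_finiteDimensional

theorem re_inner_act_herglotz_diag (hμ : IsClarkMeasure b α μ) {z : ℂ} (hz : ‖z‖ < 1)
    (u : EuclideanSpace ℂ (Fin n)) :
    (inner ℂ u (act (herglotz b α z + (herglotz b α z).conjTranspose) u)).re =
      2 * (1 - ‖z‖ ^ 2) *
        (inner ℂ u (act (matrixIntegral μ fun ζ => szegoKernel z ζ * star (szegoKernel z ζ)) u)).re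
      := by
  rw [hμ.herglotz_add_conjTranspose hz hz, act_smul, inner_smul_right,
    Complex.star_def, Complex.mul_conj, Complex.normSq_eq_norm_sq, ← Complex.re_ofReal_mul]
  push_cast
  rfl

/-- Cauchy-Schwarz for the reproducing kernel of the Herglotz space. -/
theorem IsClarkMeasure.norm_inner_herglotz_sq_le (hμ : IsClarkMeasure b α μ) {w z : ℂ}
    (hw : ‖w‖ < 1) (hz : ‖z‖ < 1) (u v : EuclideanSpace ℂ (Fin n)) :
    ‖inner ℂ v (act (herglotz b α w + (herglotz b α z).conjTranspose) u)‖ ^ 2 *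
        ((1 - ‖z‖ ^ 2) * (1 - ‖w‖ ^ 2)) ≤
      ‖1 - w * star z‖ ^ 2 *
        ((inner ℂ u (act (herglotz b α z + (herglotz b α z).conjTranspose) u)).re *
        (inner ℂ v (act (herglotz b α w + (herglotz b α w).conjTranspose) v)).re) := by
  rw [re_inner_act_herglotz_diag hμ hz, re_inner_act_herglotz_diag hμ hw,
    hμ.herglotz_add_conjTranspose hw hz, act_smul, inner_smul_right,
    norm_mul, norm_mul, Complex.norm_ofNat]
  have h := norm_inner_matrixIntegral_sq_le μ hμ.posSemidef (measurable_szegoKernel z)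
    (measurable_szegoKernel w) (C := max (1 - ‖z‖)⁻¹ (1 - ‖w‖)⁻¹)
    (fun ζ => (norm_szegoKernel_le hz ζ).trans (le_max_left _ _))
    (fun ζ => (norm_szegoKernel_le hw ζ).trans (le_max_right _ _)) u v
  have hz' : 0 ≤ 1 - ‖z‖ ^ 2 := by nlinarith [norm_nonneg z]
  have hw' : 0 ≤ 1 - ‖w‖ ^ 2 := by nlinarith [norm_nonneg w]
  have := mul_le_mul_of_nonneg_left h
    (show 0 ≤ 4 * ‖1 - w * star z‖ ^ 2 * ((1 - ‖z‖ ^ 2) * (1 - ‖w‖ ^ 2)) by positivity)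
  calc _ = _ := by ring
    _ ≤ _ := this
    _ = _ := by ring

/-- Cauchy-Schwarz between `szegoKernel z` times `u` and the indicator of `{l}` times `v`: the mixed
integral sees only the point mass. -/
theorem IsClarkMeasure.norm_inner_atom_sq_le (hμ : IsClarkMeasure b α μ) (l : UnitCircle) {z : ℂ}
    (hz : ‖z‖ < 1) (u v : EuclideanSpace ℂ (Fin n)) :
    ‖szegoKernel z l‖ ^ 2 * ‖inner ℂ v (act (μ {l}) u)‖ ^ 2 * (2 * (1 - ‖z‖ ^ 2)) ≤
      (inner ℂ u (act (herglotz b α z + (herglotz b α z).conjTranspose) u)).re *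
        (inner ℂ v (act (μ {l}) v)).re := by
  classical
  let g : UnitCircle → ℂ := ({l} : Set UnitCircle).indicator fun _ => 1
  have hg1 : ∀ ζ, ‖g ζ‖ ≤ 1 := fun ζ => by
    simp only [g, Set.indicator_apply]; split_ifs <;> simp
  have h := norm_inner_matrixIntegral_sq_le μ hμ.posSemidef (measurable_szegoKernel z)
    (g := g) (measurable_const.indicator (measurableSet_singleton l)) (C := max (1 - ‖z‖)⁻¹ 1)
    (fun ζ => (norm_szegoKernel_le hz ζ).trans (le_max_left _ _))
    (fun ζ => (hg1 ζ).trans (le_max_right _ _)) u v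
  have e1 : (fun ζ => szegoKernel z ζ * star (g ζ)) =
      ({l} : Set UnitCircle).indicator fun _ => szegoKernel z l := by
    funext ζ
    by_cases hζ : ζ = l
    · simp [g, hζ]
    · simp [g, hζ]
  have e2 : (fun ζ => g ζ * star (g ζ)) = ({l} : Set UnitCircle).indicator fun _ => (1 : ℂ) := by
    funext ζ
    by_cases hζ : ζ = l
    · simp [g, hζ]
    · simp [g, hζ]
  rw [e1, e2, matrixIntegral_indicator μ (measurableSet_singleton l),
    matrixIntegral_indicator μ (measurableSet_singleton l), one_smul, act_smul,
    inner_smul_right, norm_mul, mul_pow] at h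
  rw [re_inner_act_herglotz_diag hμ hz]
  have hz' : 0 ≤ 1 - ‖z‖ ^ 2 := by nlinarith [norm_nonneg z]
  have := mul_le_mul_of_nonneg_left h (show 0 ≤ 2 * (1 - ‖z‖ ^ 2) by positivity)
  calc _ = _ := mul_comm _ _
    _ ≤ _ := this
    _ = _ := by ring

end Kernel

/-! ### The Cayley transform between b and H -/

section Schur

open scoped Matrix.Norms.L2Operator ComplexOrder

variable {n : ℕ} {b : ℂ → Matrix (Fin n) (Fin n) ℂ} {α : Matrix (Fin n) (Fin n) ℂ}

theorem norm_mul_conjTranspose_of_unitary (hα : α ∈ Matrix.unitaryGroup (Fin n) ℂ)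
    (A : Matrix (Fin n) (Fin n) ℂ) : ‖A * α.conjTranspose‖ = ‖A‖ :=
  CStarRing.norm_mul_mem_unitary A (Unitary.star_mem hα)

theorem IsSchur.isUnit_one_sub (hb : IsSchur b) (hα : α ∈ Matrix.unitaryGroup (Fin n) ℂ)
    {z : ℂ} (hz : ‖z‖ < 1) : IsUnit (1 - b z * α.conjTranspose) := by
  have h : ‖b z * α.conjTranspose‖ < 1 := by
    rw [norm_mul_conjTranspose_of_unitary hα]
    exact hb.norm_lt_one z (by simpa using hz)
  exact isUnit_one_sub_of_norm_lt_one h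

theorem IsSchur.herglotz_mul_one_sub (hb : IsSchur b) (hα : α ∈ Matrix.unitaryGroup (Fin n) ℂ)
    {z : ℂ} (hz : ‖z‖ < 1) :
    herglotz b α z * (1 - b z * α.conjTranspose) = 1 + b z * α.conjTranspose := by
  have h := (Matrix.isUnit_iff_isUnit_det _).1 (hb.isUnit_one_sub hα hz)
  rw [herglotz, Matrix.mul_assoc, Matrix.nonsing_inv_mul _ h, Matrix.mul_one]

theorem IsSchur.one_sub_mul_herglotz (hb : IsSchur b) (hα : α ∈ Matrix.unitaryGroup (Fin n) ℂ)
    {z : ℂ} (hz : ‖z‖ < 1) :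
    (1 - b z * α.conjTranspose) * herglotz b α z = 1 + b z * α.conjTranspose := by
  have h := (Matrix.isUnit_iff_isUnit_det _).1 (hb.isUnit_one_sub hα hz)
  rw [herglotz, ← Matrix.mul_assoc,
    show ∀ c : Matrix (Fin n) (Fin n) ℂ, (1 - c) * (1 + c) = (1 + c) * (1 - c) from
      fun c => by noncomm_ring,
    Matrix.mul_assoc, Matrix.mul_nonsing_inv _ h, Matrix.mul_one]

/-- The vector `(1 - α b(z)*) x`. -/
noncomputable def defect (b : ℂ → Matrix (Fin n) (Fin n) ℂ) (α : Matrix (Fin n) (Fin n) ℂ)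
    (z : ℂ) (x : EuclideanSpace ℂ (Fin n)) : EuclideanSpace ℂ (Fin n) :=
  x - act α (act (b z).conjTranspose x)

theorem IsSchur.act_conjTranspose_herglotz_defect (hb : IsSchur b)
    (hα : α ∈ Matrix.unitaryGroup (Fin n) ℂ) {z : ℂ} (hz : ‖z‖ < 1)
    (x : EuclideanSpace ℂ (Fin n)) :
    act (herglotz b α z).conjTranspose (defect b α z x) =
      x + act α (act (b z).conjTranspose x) := by
  have h := congrArg (fun A => act A.conjTranspose x) (hb.one_sub_mul_herglotz hα hz)
  simpa only [Matrix.conjTranspose_mul, Matrix.conjTranspose_sub, Matrix.conjTranspose_add,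
    Matrix.conjTranspose_one, Matrix.conjTranspose_conjTranspose, act_mul, map_add, map_sub,
    LinearMap.add_apply, LinearMap.sub_apply, act_one, defect] using h

theorem norm_act_of_unitary (hα : α ∈ Matrix.unitaryGroup (Fin n) ℂ)
    (x : EuclideanSpace ℂ (Fin n)) : ‖act α x‖ = ‖x‖ := by
  have h : inner ℂ (act α x) (act α x) = inner ℂ x x := by
    rw [← inner_act_conjTranspose, ← act_mul]
    have : α.conjTranspose * α = 1 := Matrix.mem_unitaryGroup_iff'.1 hα
    rw [this, act_one]
  have h2 : ‖act α x‖ ^ 2 = ‖x‖ ^ 2 := by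
    rw [@norm_sq_eq_re_inner ℂ, @norm_sq_eq_re_inner ℂ, h]
  exact (sq_eq_sq₀ (norm_nonneg _) (norm_nonneg _)).1 h2

/-- With y = α b(z)*x, H(z)* sends x - y to x + y, and Re⟨x - y, x + y⟩ = ‖x‖² - ‖y‖². This turns
the Carathéodory numerator into a diagonal value of the kernel. -/
theorem IsSchur.re_inner_herglotz_defect (hb : IsSchur b)
    (hα : α ∈ Matrix.unitaryGroup (Fin n) ℂ) {z : ℂ} (hz : ‖z‖ < 1)
    (x : EuclideanSpace ℂ (Fin n)) :
    (inner ℂ (defect b α z x) (act (herglotz b α z + (herglotz b α z).conjTranspose)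
      (defect b α z x))).re = 2 * (‖x‖ ^ 2 - ‖act (b z).conjTranspose x‖ ^ 2) := by
  set y := act α (act (b z).conjTranspose x) with hy
  have hn : ‖act (b z).conjTranspose x‖ = ‖y‖ := (norm_act_of_unitary hα _).symm
  have h1 : (inner ℂ (defect b α z x) (act (herglotz b α z).conjTranspose (defect b α z x))).re =
      ‖x‖ ^ 2 - ‖y‖ ^ 2 := by
    rw [hb.act_conjTranspose_herglotz_defect hα hz, defect, ← hy, inner_sub_left, inner_add_right,
      inner_add_right, ← inner_conj_symm x y]
    rw [@norm_sq_eq_re_inner ℂ _ _ _ _ x, @norm_sq_eq_re_inner ℂ _ _ _ _ y]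
    simp only [Complex.add_re, Complex.sub_re, Complex.conj_re, RCLike.re_to_complex]
    ring
  have h2 : (inner ℂ (defect b α z x) (act (herglotz b α z) (defect b α z x))).re =
      (inner ℂ (defect b α z x) (act (herglotz b α z).conjTranspose (defect b α z x))).re := by
    rw [inner_act_conjTranspose, ← inner_conj_symm, Complex.conj_re]
  rw [act_add, inner_add_right, Complex.add_re, h2, h1, hn]
  ring

theorem tendsto_defect (hα : α ∈ Matrix.unitaryGroup (Fin n) ℂ) {l : UnitCircle}
    {x : EuclideanSpace ℂ (Fin n)} (hx : x ∈ directionalCarrier b α l) :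
    Tendsto (fun z => defect b α z x) (nontangential l) (𝓝 0) := by
  have hc : Continuous (act α) := LinearMap.continuous_of_finiteDimensional _
  have h := (tendsto_const_nhds (x := x)).sub ((hc.tendsto _).comp hx)
  have : α * α.conjTranspose = 1 := Matrix.mem_unitaryGroup_iff.1 hα
  rwa [← act_mul, this, act_one, sub_self] at h

end Schur

/-! ### Radial approach -/

section Radial

theorem norm_ofReal_mul_coe {r : ℝ} (hr : 0 < r) (l : UnitCircle) : ‖(r : ℂ) * l‖ = r := by
  simp [abs_of_pos hr]

theorem tendsto_radial (l : UnitCircle) :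
    Tendsto (fun r : ℝ => (r : ℂ) * l) (𝓝[<] 1) (nontangential l) := by
  have h : 𝓝[stolz 2 l] (l : ℂ) ≤ nontangential l :=
    le_iSup₂_of_le (2 : ℝ) (show (2 : ℝ) ∈ Set.Ioi 1 by norm_num) le_rfl
  refine Tendsto.mono_right (tendsto_nhdsWithin_iff.2 ⟨?_, ?_⟩) h
  · have : Continuous fun r : ℝ => (r : ℂ) * l := by fun_prop
    simpa using (this.tendsto 1).mono_left (nhdsWithin_le_nhds (s := Set.Iio 1))
  · filter_upwards [Ioo_mem_nhdsLT (zero_lt_one' ℝ)] with r hr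
    have hn := norm_ofReal_mul_coe hr.1 l
    have : (r : ℂ) * l - l = ((r - 1 : ℝ) : ℂ) * l := by push_cast; ring
    refine ⟨hn.trans_lt hr.2, ?_⟩
    rw [hn, this, norm_mul, norm_coe, Complex.norm_real, Real.norm_eq_abs,
      abs_of_neg (by linarith [hr.2])]
    linarith [hr.2]

end Radial

/-! ### The two inclusions -/

section Main

open scoped Matrix.Norms.L2Operator ComplexOrder

variable {n : ℕ} {b : ℂ → Matrix (Fin n) (Fin n) ℂ} {α : Matrix (Fin n) (Fin n) ℂ}
  {μ : MatrixMeasure n}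

theorem IsClarkMeasure.conjTranspose_atom (hμ : IsClarkMeasure b α μ) (l : UnitCircle) :
    (μ {l}).conjTranspose = μ {l} :=
  (hμ.posSemidef _ (measurableSet_singleton l)).isHermitian.eq

theorem IsClarkMeasure.tendsto_conjTranspose_mul_atom (hb : IsSchur b)
    (hα : α ∈ Matrix.unitaryGroup (Fin n) ℂ) (hμ : IsClarkMeasure b α μ) (l : UnitCircle) :
    Tendsto (fun z => (b z).conjTranspose * μ {l}) (nontangential l)
      (𝓝 (α.conjTranspose * μ {l})) := by
  set M := μ {l}
  have hM : M.conjTranspose = M := hμ.conjTranspose_atom l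
  have hsc := (tendsto_one_sub_star_mul l).mono_left (nontangential_le_nhds l)
  let G : ℂ → Matrix (Fin n) (Fin n) ℂ := fun z =>
    ((1 - star (l : ℂ) * z) / 2) • (herglotz b α z + 1)
  have hG : Tendsto G (nontangential l) (𝓝 M) := by
    have h := (hμ.tendsto_smul_herglotz l).add
      (hsc.smul_const (1 : Matrix (Fin n) (Fin n) ℂ))
    rw [zero_smul, add_zero] at h
    exact h.congr fun z => (smul_add _ _ _).symm
  have hGs : Tendsto (fun z => M - (G z).conjTranspose) (nontangential l) (𝓝 0) := by
    have h := ((continuous_id.matrix_conjTranspose).tendsto _).comp hG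
    have h' := (tendsto_const_nhds (x := M)).sub h
    simp only [id, hM, sub_self] at h'
    exact h'
  -- Adjoint of G(1 - bα*) = (1 - l̄z)·1, with G* replaced by M - (M - G*). Both terms on the right
  -- vanish in the limit, as 1 - bα* stays bounded.
  have hkey : ∀ᶠ z in nontangential l,
      M - (b z * α.conjTranspose).conjTranspose * M =
        (1 - b z * α.conjTranspose).conjTranspose * (M - (G z).conjTranspose) +
          (2 * star ((1 - star (l : ℂ) * z) / 2)) • 1 := by
    filter_upwards [eventually_nontangential_norm_lt_one l] with z hz
    have h : G z * (1 - b z * α.conjTranspose) =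
        (2 * ((1 - star (l : ℂ) * z) / 2)) • (1 : Matrix (Fin n) (Fin n) ℂ) := by
      simp only [G]
      rw [Matrix.smul_mul, add_mul, one_mul, hb.herglotz_mul_one_sub hα hz, mul_comm 2, mul_smul,
        two_smul]
      congr 1
      abel
    have h' := congrArg Matrix.conjTranspose h
    rw [Matrix.conjTranspose_mul, Matrix.conjTranspose_smul _ (1 : Matrix (Fin n) (Fin n) ℂ),
      Matrix.conjTranspose_one] at h'
    rw [mul_sub, h', Matrix.conjTranspose_sub, Matrix.conjTranspose_one, sub_mul, one_mul]
    simp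
  have hzero : Tendsto (fun z => M - (b z * α.conjTranspose).conjTranspose * M)
      (nontangential l) (𝓝 0) := by
    have h1 : Tendsto (fun z => (1 - b z * α.conjTranspose).conjTranspose *
        (M - (G z).conjTranspose)) (nontangential l) (𝓝 0) := by
      have hbd := (hGs.norm).const_mul (‖(1 : Matrix (Fin n) (Fin n) ℂ)‖ + 1)
      rw [norm_zero, mul_zero] at hbd
      refine squeeze_zero_norm' ?_ hbd
      filter_upwards [eventually_nontangential_norm_lt_one l] with z hz
      refine (norm_mul_le _ _).trans ?_
      gcongr
      rw [Matrix.l2_opNorm_conjTranspose]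
      refine (norm_sub_le _ _).trans ?_
      rw [norm_mul_conjTranspose_of_unitary hα]
      linarith [hb.norm_lt_one z (by simpa using hz)]
    have h2 : Tendsto (fun z : ℂ => (2 * star ((1 - star (l : ℂ) * z) / 2)) •
        (1 : Matrix (Fin n) (Fin n) ℂ)) (nontangential l) (𝓝 0) := by
      have := ((hsc.star).const_mul 2).smul_const (1 : Matrix (Fin n) (Fin n) ℂ)
      simpa using this
    have h3 := h1.add h2
    rw [add_zero] at h3
    exact h3.congr' (hkey.mono fun z hz => hz.symm)
  have hfin := (tendsto_const_nhds (x := α.conjTranspose * M)).sub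
    (hzero.const_mul α.conjTranspose)
  rw [mul_zero, sub_zero] at hfin
  refine hfin.congr fun z => ?_
  have hu : α.conjTranspose * α = 1 := Matrix.mem_unitaryGroup_iff'.1 hα
  rw [Matrix.conjTranspose_mul, Matrix.conjTranspose_conjTranspose, mul_sub, sub_sub_cancel,
    ← mul_assoc, ← mul_assoc, hu, one_mul]

theorem IsClarkMeasure.range_atom_subset_directionalCarrier (hb : IsSchur b)
    (hα : α ∈ Matrix.unitaryGroup (Fin n) ℂ) (hμ : IsClarkMeasure b α μ) (l : UnitCircle)
    (y : EuclideanSpace ℂ (Fin n)) : act (μ {l}) y ∈ directionalCarrier b α l := by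
  have h := ((continuous_act y).tendsto _).comp (hμ.tendsto_conjTranspose_mul_atom hb hα l)
  simp only [Function.comp_def, act_mul] at h
  exact h

/-- Radial bound for the Carathéodory quotient in a direction from the range of the point mass. -/
theorem IsClarkMeasure.quotient_radial_le (hb : IsSchur b)
    (hα : α ∈ Matrix.unitaryGroup (Fin n) ℂ) (hμ : IsClarkMeasure b α μ) (l : UnitCircle)
    (y : EuclideanSpace ℂ (Fin n)) {r : ℝ} (hr0 : 0 < r) (hr1 : r < 1) :
    (‖act (μ {l}) y‖ ^ 2 - ‖act (b (r * l)).conjTranspose (act (μ {l}) y)‖ ^ 2) /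
      (1 - ‖(r : ℂ) * l‖ ^ 2) ≤ 4 * (inner ℂ y (act (μ {l}) y)).re := by
  have hP := hμ.posSemidef _ (measurableSet_singleton l)
  set M := μ {l}
  set x := act M y with hx
  set z : ℂ := r * l with hz
  have hzr : ‖z‖ = r := norm_ofReal_mul_coe hr0 l
  have hz1 : ‖z‖ < 1 := hzr ▸ hr1
  set u := defect b α z x with hu
  set q := ‖x‖ ^ 2 - ‖act (b z).conjTranspose x‖ ^ 2 with hq
  have hm : 0 ≤ (inner ℂ y (act M y)).re := re_inner_act_nonneg hP y
  have h1 := hμ.norm_inner_atom_sq_le l hz1 u y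
  rw [hb.re_inner_herglotz_defect hα hz1] at h1
  have hk : ‖szegoKernel z l‖ = (1 - r)⁻¹ := by
    have : 1 - star z * (l : ℂ) = ((1 - r : ℝ) : ℂ) := by
      rw [hz, star_mul, mul_right_comm, star_mul_coe]
      simp
    rw [szegoKernel, this, norm_inv, Complex.norm_real, Real.norm_eq_abs,
      abs_of_pos (by linarith)]
  rw [hk, hzr, ← hq] at h1
  -- Since α is unitary, q = ‖x‖² - ‖x - u‖² = 2 Re⟨x, u⟩ - ‖u‖², and ⟨x, u⟩ = ⟨y, Mu⟩. Squaring
  -- produces the constant 4.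
  have h2 : q ≤ 2 * ‖inner ℂ y (act M u)‖ := by
    have e1 : inner ℂ y (act M u) = inner ℂ x u := by
      rw [hx, ← inner_act_conjTranspose, hP.isHermitian.eq]
    have e2 : ‖act (b z).conjTranspose x‖ = ‖x - u‖ := by
      rw [← norm_act_of_unitary hα (act (b z).conjTranspose x), hu, defect, sub_sub_cancel]
    rw [e1, hq, e2, @norm_sub_sq ℂ]
    have := Complex.re_le_norm (inner ℂ x u)
    simp only [RCLike.re_to_complex]
    nlinarith [sq_nonneg ‖u‖]
  rw [hzr]
  have hr2 : 0 < 1 - r ^ 2 := by nlinarith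
  rw [div_le_iff₀ hr2]
  rcases le_or_gt q 0 with hq0 | hq0
  · exact hq0.trans (by positivity)
  have h3 : q ^ 2 ≤ 4 * ‖inner ℂ y (act M u)‖ ^ 2 := by nlinarith
  have hr3 : 0 < 1 - r := by linarith
  have h4 : ‖inner ℂ y (act M u)‖ ^ 2 * (1 - r ^ 2) ≤
      (1 - r) ^ 2 * (q * (inner ℂ y (act M y)).re) := by
    rw [inv_pow, mul_assoc, inv_mul_le_iff₀ (by positivity)] at h1
    nlinarith
  have h5 : q * (q * (1 - r ^ 2)) ≤ q * (4 * (1 - r) ^ 2 * (inner ℂ y (act M y)).re) := by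
    nlinarith
  have h6 := le_of_mul_le_mul_left h5 hq0
  -- The difference of the two sides is (1 - r)²((1 + r)² - 1).
  have h7 : (1 - r) ^ 2 ≤ (1 - r ^ 2) * (1 - r ^ 2) := by
    have : 0 ≤ (1 - r) ^ 2 * (r * (2 + r)) := by positivity
    nlinarith
  have h8 := mul_le_mul_of_nonneg_right h7 hm
  have h9 : q * (1 - r ^ 2) ≤
      4 * (inner ℂ y (act M y)).re * (1 - r ^ 2) * (1 - r ^ 2) := by linarith
  exact le_of_mul_le_mul_right h9 hr2

theorem IsClarkMeasure.range_atom_subset_caratheodory (hb : IsSchur b)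
    (hα : α ∈ Matrix.unitaryGroup (Fin n) ℂ) (hμ : IsClarkMeasure b α μ) (l : UnitCircle)
    (y : EuclideanSpace ℂ (Fin n)) : CaratheodoryCondition b l (act (μ {l}) y) := by
  refine lt_of_le_of_lt (liminf_le_of_frequently_le
    (a := ((4 * (inner ℂ y (act (μ {l}) y)).re : ℝ) : EReal)) ?_) (EReal.coe_lt_top _)
  -- A lower limit needs the bound only frequently, so the radius suffices.
  refine (tendsto_radial l).frequently (Eventually.frequently ?_)
  filter_upwards [Ioo_mem_nhdsLT (zero_lt_one' ℝ)] with r hr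
  exact EReal.coe_le_coe_iff.2 (hμ.quotient_radial_le hb hα l y hr.1 hr.2)

/-- In a direction that satisfies the Carathéodory condition, the pairing with any vector is bounded
by the Herglotz function at every point of the disc. -/
theorem IsClarkMeasure.norm_inner_sq_le_of_frequently (hb : IsSchur b)
    (hα : α ∈ Matrix.unitaryGroup (Fin n) ℂ) (hμ : IsClarkMeasure b α μ) {l : UnitCircle}
    {x : EuclideanSpace ℂ (Fin n)} (hx : x ∈ directionalCarrier b α l) {A : ℝ}
    (hA : ∃ᶠ z in nontangential l,
      (‖x‖ ^ 2 - ‖act (b z).conjTranspose x‖ ^ 2) / (1 - ‖z‖ ^ 2) ≤ A)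
    {w : ℂ} (hw : ‖w‖ < 1) (v : EuclideanSpace ℂ (Fin n)) :
    4 * ‖inner ℂ v x‖ ^ 2 * (1 - ‖w‖ ^ 2) ≤ ‖1 - w * star (l : ℂ)‖ ^ 2 *
      (2 * A * (2 * (inner ℂ v (act (herglotz b α w) v)).re)) := by
  have hd := tendsto_defect hα hx
  have hc : Continuous (act (herglotz b α w)) := LinearMap.continuous_of_finiteDimensional _
  -- This vector is (H(w) + H(z)*)u, with α b(z)*x written as x - u; u → 0 leaves 2x.
  have hlim : Tendsto (fun z => act (herglotz b α w) (defect b α z x) +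
      (x + (x - defect b α z x))) (nontangential l) (𝓝 ((2 : ℂ) • x)) := by
    have h := ((hc.tendsto 0).comp hd).add
      ((tendsto_const_nhds (x := x)).add ((tendsto_const_nhds (x := x)).sub hd))
    rw [map_zero, zero_add, sub_zero, ← two_smul ℂ] at h
    exact h
  have hL : Tendsto (fun z => ‖inner ℂ v (act (herglotz b α w) (defect b α z x) +
      (x + (x - defect b α z x)))‖ ^ 2 * (1 - ‖w‖ ^ 2)) (nontangential l)
      (𝓝 (4 * ‖inner ℂ v x‖ ^ 2 * (1 - ‖w‖ ^ 2))) := by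
    have h := (((tendsto_const_nhds (x := v)).inner (𝕜 := ℂ) hlim).norm.pow 2).mul_const
      (1 - ‖w‖ ^ 2)
    rw [inner_smul_right, norm_mul, mul_pow, Complex.norm_ofNat] at h
    norm_num at h
    exact h
  have hR : Tendsto (fun z : ℂ => ‖1 - w * star z‖ ^ 2 *
      (2 * A * (2 * (inner ℂ v (act (herglotz b α w) v)).re))) (nontangential l)
      (𝓝 (‖1 - w * star (l : ℂ)‖ ^ 2 *
        (2 * A * (2 * (inner ℂ v (act (herglotz b α w) v)).re)))) := by
    have : Continuous fun z : ℂ => ‖1 - w * star z‖ ^ 2 *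
      (2 * A * (2 * (inner ℂ v (act (herglotz b α w) v)).re)) := by fun_prop
    exact (this.tendsto _).mono_left (nontangential_le_nhds l)
  -- Both sides converge, so an inequality that holds frequently survives in the limit.
  refine le_of_tendsto_of_tendsto_of_frequently hL hR ?_
  refine (hA.and_eventually (eventually_nontangential_norm_lt_one l)).mono fun z hz => ?_
  obtain ⟨hzA, hz⟩ := hz
  have hz2 : 0 < 1 - ‖z‖ ^ 2 := by nlinarith [norm_nonneg z]
  have h := hμ.norm_inner_herglotz_sq_le hw hz (defect b α z x) v
  rw [hb.re_inner_herglotz_defect hα hz, act_add,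
    hb.act_conjTranspose_herglotz_defect hα hz] at h
  rw [show act α (act (b z).conjTranspose x) = x - defect b α z x by
    rw [defect, sub_sub_cancel]] at h
  have hre : (inner ℂ v (act (herglotz b α w + (herglotz b α w).conjTranspose) v)).re =
      2 * (inner ℂ v (act (herglotz b α w) v)).re := by
    rw [act_add, inner_add_right, inner_act_conjTranspose,
      ← inner_conj_symm (act _ v) v, Complex.add_re, Complex.conj_re]
    ring
  have hpos : 0 ≤ (inner ℂ v (act (herglotz b α w + (herglotz b α w).conjTranspose) v)).re := by
    rw [re_inner_act_herglotz_diag hμ hw]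
    have hform := matrixIntegral_form_nonneg μ hμ.posSemidef (measurable_szegoKernel w)
      (measurable_szegoKernel w) (norm_szegoKernel_le hw) (norm_szegoKernel_le hw) v 0
    simp only [inner_zero_left, Complex.zero_re, mul_zero, add_zero] at hform
    have : 0 ≤ 1 - ‖w‖ ^ 2 := by nlinarith [norm_nonneg w]
    positivity
  rw [hre] at h hpos
  rw [div_le_iff₀ hz2] at hzA
  set R := 2 * (inner ℂ v (act (herglotz b α w) v)).re
  set N := ‖inner ℂ v (act (herglotz b α w) (defect b α z x) + (x + (x - defect b α z x)))‖
  have hK : 0 ≤ ‖1 - w * star z‖ ^ 2 * (2 * R) := by positivity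
  have h2 := mul_le_mul_of_nonneg_left hzA hK
  have h3 : N ^ 2 * (1 - ‖w‖ ^ 2) * (1 - ‖z‖ ^ 2) ≤
      ‖1 - w * star z‖ ^ 2 * (2 * A * R) * (1 - ‖z‖ ^ 2) := by
    calc _ = N ^ 2 * ((1 - ‖z‖ ^ 2) * (1 - ‖w‖ ^ 2)) := by ring
      _ ≤ _ := h
      _ = _ := by ring
      _ ≤ _ := h2
      _ = _ := by ring
  exact le_of_mul_le_mul_right h3 hz2

/-- At w = rl the previous bound has the factor (1 - r)² against 1 - r². Dividing by 1 - r leaves (1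
- r)/2 · H(rl), which tends to the point mass. -/
theorem IsClarkMeasure.norm_inner_sq_le_atom (hb : IsSchur b)
    (hα : α ∈ Matrix.unitaryGroup (Fin n) ℂ) (hμ : IsClarkMeasure b α μ) {l : UnitCircle}
    {x : EuclideanSpace ℂ (Fin n)} (hx : x ∈ directionalCarrier b α l) {A : ℝ}
    (hA : ∃ᶠ z in nontangential l,
      (‖x‖ ^ 2 - ‖act (b z).conjTranspose x‖ ^ 2) / (1 - ‖z‖ ^ 2) ≤ A)
    (v : EuclideanSpace ℂ (Fin n)) :
    ‖inner ℂ v x‖ ^ 2 ≤ A * (inner ℂ v (act (μ {l}) v)).re := by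
  have hlim := (Complex.continuous_re.tendsto _).comp (((continuous_inner_act v v).tendsto _).comp
    ((hμ.tendsto_smul_herglotz l).comp (tendsto_radial l)))
  have hL : Tendsto (fun r : ℝ => ‖inner ℂ v x‖ ^ 2 * (1 + r) / 2) (𝓝[<] 1)
      (𝓝 (‖inner ℂ v x‖ ^ 2)) := by
    have : Continuous fun r : ℝ => ‖inner ℂ v x‖ ^ 2 * (1 + r) / 2 := by fun_prop
    have h := (this.tendsto 1).mono_left (nhdsWithin_le_nhds (s := Set.Iio 1))
    convert h using 2
    ring
  refine le_of_tendsto_of_tendsto hL (hlim.const_mul A) ?_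
  filter_upwards [Ioo_mem_nhdsLT (zero_lt_one' ℝ)] with r hr
  have hn := norm_ofReal_mul_coe hr.1 l
  have h := hμ.norm_inner_sq_le_of_frequently hb hα hx hA (hn.trans_lt hr.2) v
  have e1 : (1 : ℂ) - r * l * star (l : ℂ) = ((1 - r : ℝ) : ℂ) := by
    rw [mul_assoc, mul_comm (l : ℂ), star_mul_coe]; push_cast; ring
  have e2 : (1 : ℂ) - star (l : ℂ) * (r * l) = ((1 - r : ℝ) : ℂ) := by
    rw [mul_left_comm, star_mul_coe]; push_cast; ring
  rw [e1, hn, Complex.norm_real, Real.norm_eq_abs, sq_abs] at h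
  simp only [Function.comp]
  rw [e2, act_smul, inner_smul_right,
    show (((1 - r : ℝ) : ℂ) / 2) = (((1 - r) / 2 : ℝ) : ℂ) by push_cast; ring,
    Complex.re_ofReal_mul]
  have hr1 : 0 < 1 - r := by linarith [hr.2]
  refine le_of_mul_le_mul_left ?_ hr1
  nlinarith

end Main

end ClarkMeasure

open ClarkMeasure in
theorem theorem8p3 {n : ℕ} (b : ℂ → Matrix (Fin n) (Fin n) ℂ) (hb : IsSchur b)
    (α : Matrix (Fin n) (Fin n) ℂ) (hα : α ∈ Matrix.unitaryGroup (Fin n) ℂ)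
    (μ : MatrixMeasure n) (hμ : IsClarkMeasure b α μ) (l : UnitCircle) :
    (LinearMap.range (act (μ {l})) : Set (EuclideanSpace ℂ (Fin n))) =
      caratheodorySpace b α l := by
  ext x
  constructor
  · rintro ⟨y, rfl⟩
    exact ⟨hμ.range_atom_subset_directionalCarrier hb hα l y,
      hμ.range_atom_subset_caratheodory hb hα l y⟩
  · rintro ⟨hx, hC⟩
    obtain ⟨A, hA, -⟩ := EReal.lt_iff_exists_real_btwn.1 hC
    have hfreq := (frequently_lt_of_liminf_lt (by isBoundedDefault) hA).mono
      fun z hz => (EReal.coe_lt_coe_iff.1 hz).le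
    have hH := hμ.conjTranspose_atom l
    change x ∈ LinearMap.range (act (μ {l}))
    -- In finite dimension the range equals its double orthogonal, so it is enough to test `x`
    -- against the orthogonal complement, which lies in the kernel of the Hermitian point mass.
    rw [← Submodule.orthogonal_orthogonal (LinearMap.range (act (μ {l}))),
      Submodule.mem_orthogonal]
    intro v hv
    have hv0 : act (μ {l}) v = 0 := by
      rw [← inner_self_eq_zero (𝕜 := ℂ), ← inner_act_conjTranspose, hH,
        ← inner_conj_symm, (Submodule.mem_orthogonal _ v).1 hv _ ⟨_, rfl⟩, map_zero]
    have h := hμ.norm_inner_sq_le_atom hb hα hx hfreq v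
    rw [hv0, inner_zero_right, Complex.zero_re, mul_zero] at h
    exact norm_eq_zero.1 (pow_eq_zero_iff two_ne_zero |>.1 (le_antisymm h (sq_nonneg _)))
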